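/- Let $\mathcal V$ be a finite set and $\mathcal G=(\mathcal V,\mathcal E)$ an acyclic directed graph (no directed cycles, in particular no self-loops). Let $\mathcal N_i^+=\{j:(i,j)\in\mathcal E\}$ and $\mathcal N_j^-=\{i:(i,j)\in\mathcal E\}$ be the sets of out-neighbours and in-neighbours. Let $\mathcal R,\mathcal C\subseteq\mathcal V$ (the excited and the measured vertices) satisfy $\mathcal R\cup\mathcal C=\mathcal V$. Let $\Theta$ be a parameter set and, for each $\theta\in\Theta$, let $G(q,\theta)$ be a $\mathcal V\times\mathcal V$ matrix over the field $\mathbb R(q)$ of real rational functions with $G_{ji}(q,\theta)=0$ whenever $(i,j)\notin\mathcal E$. Put $T(q,\theta)=(I-G(q,\theta))^{-1}$, $R=[I]_{\star,\mathcal R}$, $C=[I]_{\mathcal C,\star}$, and $\mathcal M=\{(G(q,\theta),R,C):\theta\in\Theta\}$. (This covers in particular every stable network model set with proper, independently parameterized modules; these properties are not needed.) Write $[A]_{\mathcal U,\mathcal W}$ for the submatrix of $A$ with rows $\mathcal U$ and columns $\mathcal W$, and let $\mathrm{Rank}$ denote normal rank: $\mathrm{Rank}(A(q))=r$ if $A(z)$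 has rank $r$ for all but finitely many $z\in\mathbb C$. The model set $\mathcal M$ is called identifiable from $[T]_{\mathcal C,\mathcal R}$ if for every edge $(i,j)\in\mathcal E$ and all $\theta_0,\theta_1\in\Theta$, $$C\,T(q,\theta_1)\,R=C\,T(q,\theta_0)\,R\ \Longrightarrow\ G_{ji}(q,\theta_1)=G_{ji}(q,\theta_0).$$ Suppose that: 1. every excited vertex $i\in\mathcal R$ satisfies, for all $\theta\in\Theta$, $\mathrm{Rank}\big([T(q,\theta)]_{\mathcal C,\mathcal N_i^+}\big)=|\mathcal N_i^+|$; 2. for every unexcited (hence measured) vertex $i\in\mathcal C\setminus\mathcal R$ there are sets $\mathcal C_i\subseteq\mathcal C$ and $\mathcal R_i\subseteq\mathcal R$ with $\widehat{\mathcal N}_i^+\subseteq\mathcal R_i$ and $i\in\mathcal C_i$ such that, for all $\theta\in\Theta$, $$\mathrm{Rank}\big([T(q,\theta)]_{\mathcal C_i,\mathcal R_i}\big)=|\mathcal C_i|,\qquad \mathrm{Rank}\big([T(q,\theta)]_{(\mathcal C_i\cup\mathcal S_i)\setminus\{i\},\,\mathcal R_i}\big)=|\mathcal C_i|-1,$$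 where $\widehat{\mathcal N}_i^+=\mathcal N_i^+\setminus\mathcal C$ is the set of unmeasured out-neighbours of $i$ and $\mathcal S_i=\widehat{\mathcal N}_i^+\cup\bigcup_{j\in\mathcal N_i^+}\mathcal N_j^-$. Then $\mathcal M$ is identifiable from $[T]_{\mathcal C,\mathcal R}$. -/

import Mathlib

noncomputable section

/-- The submatrix `[A]_{U,W}`: rows indexed by `U`, columns indexed by `W`. -/
def subMat {V F : Type*} (A : Matrix V V F) (U W : Finset V) :
    Matrix {x // x ∈ U} {x // x ∈ W} F :=
  A.submatrix Subtype.val Subtype.val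

/-- A matrix `A(q)` of real rational functions has normal rank `r` if the complex matrix `A(z)`
has rank `r` for all but finitely many complex values `z` of the variable `q`.
(At one of the finitely many poles `RatFunc.eval` takes a junk value, which does not matter.) -/
def HasNormalRank {m n : Type*} [Fintype n] (A : Matrix m n (RatFunc ℝ)) (r : ℕ) : Prop :=
  ∀ᶠ z : ℂ in Filter.cofinite, (A.map (RatFunc.eval (algebraMap ℝ ℂ) z)).rank = r

/-- A directed graph is acyclic if no two (possibly equal) vertices can reach each other along
directed edges; in particular there are no self-loops. -/
def Digraph.AcyclicGraph {V : Type*} (𝒢 : Digraph V) : Prop :=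
  ∀ i j, ¬ (Relation.TransGen 𝒢.Adj i j ∧ Relation.TransGen 𝒢.Adj j i)

/-- The set `N_i^+` of out-neighbours of `i`. -/
def Digraph.outNbrs {V : Type*} [Fintype V] (𝒢 : Digraph V) (i : V) : Finset V :=
  open Classical in Finset.univ.filter fun j => 𝒢.Adj i j

/-- The set `N_j^-` of in-neighbours of `j`. -/
def Digraph.inNbrs {V : Type*} [Fintype V] (𝒢 : Digraph V) (j : V) : Finset V :=
  open Classical in Finset.univ.filter fun i => 𝒢.Adj i j

/-- A network model set `{(G(q,θ), R, C) : θ ∈ Θ}` on a directed graph with vertex set `V`.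
The entry `G θ j i` is the module from vertex `i` to vertex `j`; it vanishes unless `(i, j)` is an
edge. -/
structure NetworkModelSet (V Θ : Type*) where
  /-- the topology of the network -/
  graph : Digraph V
  /-- the network matrix `G(q,θ)` -/
  G : Θ → Matrix V V (RatFunc ℝ)
  /-- modules exist only along edges -/
  G_eq_zero : ∀ θ i j, ¬ graph.Adj i j → G θ j i = 0
  /-- the set of excited vertices -/
  excited : Finset V
  /-- the set of measured vertices -/
  measured : Finset V

namespace NetworkModelSet

variable {V Θ : Type*} [Fintype V] [DecidableEq V] (M : NetworkModelSet V Θ)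

/-- The transfer matrix `T(q,θ) = (I - G(q,θ))⁻¹`. -/
def T (θ : Θ) : Matrix V V (RatFunc ℝ) := (1 - M.G θ)⁻¹

/-- The excitation matrix `R = [I]_{⋆,R}`. -/
def excitationMatrix : Matrix V {x // x ∈ M.excited} (RatFunc ℝ) :=
  (1 : Matrix V V (RatFunc ℝ)).submatrix id Subtype.val

/-- The measurement matrix `C = [I]_{C,⋆}`. -/
def measurementMatrix : Matrix {x // x ∈ M.measured} V (RatFunc ℝ) :=
  (1 : Matrix V V (RatFunc ℝ)).submatrix Subtype.val id

/-- The module `G_{ji}` (from `i` to `j`) is identifiable from `[T]_{C,R}`. -/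
def ModuleIdentifiable (j i : V) : Prop :=
  ∀ θ₀ θ₁ : Θ,
    M.measurementMatrix * M.T θ₁ * M.excitationMatrix =
      M.measurementMatrix * M.T θ₀ * M.excitationMatrix →
    M.G θ₁ j i = M.G θ₀ j i

/-- The model set is (globally) identifiable from `[T]_{C,R}`: every module is. -/
def Identifiable : Prop :=
  ∀ i j, M.graph.Adj i j → M.ModuleIdentifiable j i

/-- The unmeasured out-neighbours of `i`. -/
def unmeasuredOutNbrs (i : V) : Finset V := M.graph.outNbrs i \ M.measured

/-- `S_i`: the unmeasured out-neighbours of `i` together with all in-neighbours of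
out-neighbours of `i`. -/
def dualS (i : V) : Finset V :=
  M.unmeasuredOutNbrs i ∪ (M.graph.outNbrs i).biUnion M.graph.inNbrs

end NetworkModelSet

end

/-! Since `T = 1 + G T = 1 + T G`, rows of `T` satisfy relations over in-neighbours and columns over
out-neighbours. Normal rank is rank over the field of rational functions, so all conditions become
linear algebra there. For unexcited `i`, restrict row `j` of `T = 1 + G T` to the columns `R_i` and
work modulo the span of the rows `C_i \ {i}`. The second rank condition kills every in-neighbour row
except row `i`, and also row `j` if `j` is unmeasured. The span is the same for both parameters
because its entries are measured and excited; row `i` lies outside it by the first condition. Hence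
`G_{ji}` is determined (`G_eq_of_dual_rank`). Acyclicity then allows induction from the sinks: an
unexcited column of `T`, on the measured rows, is recovered from its out-neighbours' columns and the
modules just found. With all columns known, column independence gives the modules leaving excited
vertices (`G_eq_of_column_rank`). -/

open Matrix Filter

/-! ### Normal rank versus rank over the function field -/

section NormalRank

lemma RatFunc.eventually_eval_denom_ne_zero (f : RatFunc ℝ) :
    ∀ᶠ z : ℂ in cofinite, f.denom.eval₂ (algebraMap ℝ ℂ) z ≠ 0 := by
  have hne : f.denom.map (algebraMap ℝ ℂ) ≠ 0 :=
    (Polynomial.map_ne_zero_iff (algebraMap ℝ ℂ).injective).2 f.denom_ne_zero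
  refine ((f.denom.map (algebraMap ℝ ℂ)).roots.toFinset.finite_toSet).subset ?_
  intro z hz
  simp only [Set.mem_compl_iff, Set.mem_ofPred_eq, not_not] at hz
  simp [hne, Polynomial.IsRoot, Polynomial.eval_map, hz]

lemma RatFunc.eventually_eval_mul (f g : RatFunc ℝ) :
    ∀ᶠ z : ℂ in cofinite, RatFunc.eval (algebraMap ℝ ℂ) z (f * g) =
      RatFunc.eval (algebraMap ℝ ℂ) z f * RatFunc.eval (algebraMap ℝ ℂ) z g := by
  filter_upwards [f.eventually_eval_denom_ne_zero, g.eventually_eval_denom_ne_zero] with z hf hg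
  exact RatFunc.eval_mul _ _ hf hg

lemma RatFunc.eventually_eval_sum {ι : Type*} (s : Finset ι) (f : ι → RatFunc ℝ) :
    ∀ᶠ z : ℂ in cofinite, RatFunc.eval (algebraMap ℝ ℂ) z (∑ k ∈ s, f k) =
      ∑ k ∈ s, RatFunc.eval (algebraMap ℝ ℂ) z (f k) := by
  classical
  induction s using Finset.induction_on with
  | empty => simp
  | insert a s ha ih =>
    filter_upwards [ih, (f a).eventually_eval_denom_ne_zero,
      (∑ k ∈ s, f k).eventually_eval_denom_ne_zero] with z hz h1 h2
    rw [Finset.sum_insert ha, Finset.sum_insert ha, RatFunc.eval_add _ _ h1 h2, hz]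

lemma Matrix.eventually_map_eval_mul {l m n : Type*} [Finite l] [Fintype m] [Finite n]
    (A : Matrix l m (RatFunc ℝ)) (B : Matrix m n (RatFunc ℝ)) :
    ∀ᶠ z : ℂ in cofinite, (A * B).map (RatFunc.eval (algebraMap ℝ ℂ) z) =
      A.map (RatFunc.eval (algebraMap ℝ ℂ) z) * B.map (RatFunc.eval (algebraMap ℝ ℂ) z) := by
  have h : ∀ᶠ z : ℂ in cofinite, ∀ i j,
      RatFunc.eval (algebraMap ℝ ℂ) z (∑ k, A i k * B k j) =
        ∑ k, RatFunc.eval (algebraMap ℝ ℂ) z (A i k) * RatFunc.eval (algebraMap ℝ ℂ) z (B k j) := by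
    refine eventually_all.2 fun i => eventually_all.2 fun j => ?_
    have hmul : ∀ᶠ z : ℂ in cofinite, ∀ k, RatFunc.eval (algebraMap ℝ ℂ) z (A i k * B k j) =
        RatFunc.eval (algebraMap ℝ ℂ) z (A i k) * RatFunc.eval (algebraMap ℝ ℂ) z (B k j) :=
      eventually_all.2 fun k => RatFunc.eventually_eval_mul _ _
    filter_upwards [RatFunc.eventually_eval_sum Finset.univ fun k => A i k * B k j, hmul]
      with z hz hk
    rw [hz]
    exact Finset.sum_congr rfl fun k _ => hk k
  filter_upwards [h] with z hz
  ext i j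
  simpa [Matrix.mul_apply] using hz i j

/-- Rank factorization of a matrix over a field, with one-sided inverses of the factors. -/
lemma Matrix.exists_rank_factorization {K m n : Type*} [Field K] [Fintype m] [Fintype n]
    (A : Matrix m n K) :
    ∃ (B : Matrix m (Fin A.rank) K) (C : Matrix (Fin A.rank) n K)
      (L : Matrix (Fin A.rank) m K) (R : Matrix n (Fin A.rank) K),
      A = B * C ∧ L * B = 1 ∧ C * R = 1 := by
  classical
  let e : LinearMap.range A.mulVecLin ≃ₗ[K] (Fin A.rank → K) :=
    LinearEquiv.ofFinrankEq _ _ (by rw [Module.finrank_fin_fun]; rfl)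
  let b : (Fin A.rank → K) →ₗ[K] (m → K) :=
    (LinearMap.range A.mulVecLin).subtype ∘ₗ e.symm.toLinearMap
  let c : (n → K) →ₗ[K] (Fin A.rank → K) := e.toLinearMap ∘ₗ A.mulVecLin.rangeRestrict
  obtain ⟨l, hl⟩ := b.exists_leftInverse_of_injective <| LinearMap.ker_eq_bot.2 <|
    (Submodule.subtype_injective _).comp e.symm.injective
  obtain ⟨r, hr⟩ := c.exists_rightInverse_of_surjective <| LinearMap.range_eq_top.2 <|
    e.surjective.comp A.mulVecLin.surjective_rangeRestrict
  refine ⟨LinearMap.toMatrix' b, LinearMap.toMatrix' c, LinearMap.toMatrix' l,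
    LinearMap.toMatrix' r, ?_, ?_, ?_⟩
  · have hbc : b ∘ₗ c = A.mulVecLin := by
      ext1 x
      ext1
      simp [b, c]
    rw [← LinearMap.toMatrix'_comp, hbc, ← Matrix.toLin'_apply', LinearMap.toMatrix'_toLin']
  · rw [← LinearMap.toMatrix'_comp, hl, LinearMap.toMatrix'_id]
  · rw [← LinearMap.toMatrix'_comp, hr, LinearMap.toMatrix'_id]

/-- The rank over the field of rational functions is the normal rank. -/
lemma Matrix.hasNormalRank_rank {m n : Type*} [Fintype m] [Fintype n]
    (A : Matrix m n (RatFunc ℝ)) : HasNormalRank A A.rank := by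
  -- The identities `A = B * C`, `L * B = 1`, `C * R = 1` survive evaluation at almost every `z`,
  -- and they pin the rank of `A(z)`.
  obtain ⟨B, C, L, R, hA, hL, hR⟩ := A.exists_rank_factorization
  filter_upwards [eventually_map_eval_mul B C, eventually_map_eval_mul L B,
    eventually_map_eval_mul C R] with z hBC hLB hCR
  have hone : (1 : Matrix (Fin A.rank) (Fin A.rank) (RatFunc ℝ)).map
      (RatFunc.eval (algebraMap ℝ ℂ) z) = 1 :=
    Matrix.map_one _ (RatFunc.eval_zero _ _) (RatFunc.eval_one _ _)
  rw [hL, hone] at hLB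
  rw [hR, hone] at hCR
  have hAz : A.map (RatFunc.eval (algebraMap ℝ ℂ) z) =
      B.map (RatFunc.eval (algebraMap ℝ ℂ) z) * C.map (RatFunc.eval (algebraMap ℝ ℂ) z) := by
    rw [← hBC, ← hA]
  generalize A.map (RatFunc.eval (algebraMap ℝ ℂ) z) = A' at hAz ⊢
  generalize B.map (RatFunc.eval (algebraMap ℝ ℂ) z) = B' at hAz hLB
  generalize C.map (RatFunc.eval (algebraMap ℝ ℂ) z) = C' at hAz hCR
  generalize L.map (RatFunc.eval (algebraMap ℝ ℂ) z) = L' at hLB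
  generalize R.map (RatFunc.eval (algebraMap ℝ ℂ) z) = R' at hCR
  apply le_antisymm
  · rw [hAz]
    exact (rank_mul_le_left _ _).trans ((rank_le_card_width _).trans_eq (Fintype.card_fin _))
  · have h1 : L' * A' * R' = 1 := by
      rw [hAz, ← Matrix.mul_assoc, ← hLB, Matrix.one_mul, ← hCR]
    calc A.rank = (L' * A' * R').rank := by rw [h1, rank_one, Fintype.card_fin]
      _ ≤ (L' * A').rank := rank_mul_le_left _ _
      _ ≤ A'.rank := rank_mul_le_right _ _

lemma HasNormalRank.rank_eq {m n : Type*} [Fintype m] [Fintype n]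
    {A : Matrix m n (RatFunc ℝ)} {r : ℕ} (h : HasNormalRank A r) : A.rank = r := by
  -- Two cofinite sets of complex numbers meet, so the normal rank is unique.
  obtain ⟨z, h1, h2⟩ := (A.hasNormalRank_rank.and h).exists
  exact h1.symm.trans h2

end NormalRank

/-! ### Rank conditions as independence and span statements -/

section Rank

variable {V K : Type*} [Field K]

lemma rank_subMat (A : Matrix V V K) (U W : Finset V) :
    (subMat A U W).rank =
      Module.finrank K (Submodule.span K ((fun k (w : {x // x ∈ W}) => A k w) '' (U : Set V))) := by
  rw [Matrix.rank_eq_finrank_span_row, Set.image_eq_range]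
  rfl

/-- A submatrix of full row rank has linearly independent rows. -/
lemma linearIndepOn_of_rank_subMat {A : Matrix V V K} {U W : Finset V}
    (h : (subMat A U W).rank = U.card) :
    LinearIndepOn K (fun k (w : {x // x ∈ W}) => A k w) (U : Set V) := by
  have h' : LinearIndependent K (subMat A U W).row := by
    rw [linearIndependent_iff_card_eq_finrank_span, Set.finrank,
      ← Matrix.rank_eq_finrank_span_row, h, Fintype.card_coe]
  exact h'

/-- A submatrix of full column rank has trivial kernel. -/
lemma eq_zero_of_rank_subMat {A : Matrix V V K} {U W : Finset V}
    (h : (subMat A U W).rank = W.card) {x : V → K}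
    (hx : ∀ u ∈ U, ∑ w ∈ W, A u w * x w = 0) {w : V} (hw : w ∈ W) : x w = 0 := by
  have hli : LinearIndependent K (subMat A U W).col := by
    rw [linearIndependent_iff_card_eq_finrank_span, Set.finrank,
      ← Matrix.rank_eq_finrank_span_cols, h, Fintype.card_coe]
  refine Fintype.linearIndependent_iff.1 hli (fun w => x w) ?_ ⟨w, hw⟩
  ext u
  have := hx u u.2
  rw [← Finset.sum_coe_sort] at this
  simpa [subMat, Matrix.col, mul_comm] using this

/-- If `U` has independent rows and adjoining the rows `S` to `U \ {i}` does not raise the rank,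
then the rows `S \ {i}` lie in the span of the rows `U \ {i}`. -/
lemma mem_span_of_rank_subMat [DecidableEq V] {A : Matrix V V K} {U S W : Finset V} {i : V}
    (hi : i ∈ U) (hU : (subMat A U W).rank = U.card)
    (hS : (subMat A ((U ∪ S) \ {i}) W).rank = U.card - 1) {k : V} (hk : k ∈ S) (hki : k ≠ i) :
    (fun w : {x // x ∈ W} => A k w) ∈
      Submodule.span K ((fun k (w : {x // x ∈ W}) => A k w) '' (U.erase i : Set V)) := by
  have hli : LinearIndepOn K (fun k (w : {x // x ∈ W}) => A k w) (U.erase i : Set V) :=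
    (linearIndepOn_of_rank_subMat hU).mono (by simp)
  have hle : Submodule.span K ((fun k (w : {x // x ∈ W}) => A k w) '' (U.erase i : Set V)) ≤
      Submodule.span K
        ((fun k (w : {x // x ∈ W}) => A k w) '' (((U ∪ S) \ {i} : Finset V) : Set V)) := by
    refine Submodule.span_mono (Set.image_mono fun x hx => ?_)
    simp only [Finset.coe_erase, Set.mem_sdiff, Finset.mem_coe, Set.mem_singleton_iff] at hx
    simp [hx]
  -- The smaller span already has dimension `U.card - 1`, by independence of its rows, so the
  -- inclusion is an equality.
  have heq := Submodule.eq_of_le_of_finrank_eq hle <| by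
    have hcard : Module.finrank K (Submodule.span K
        ((fun k (w : {x // x ∈ W}) => A k w) '' (U.erase i : Set V))) = U.card - 1 := by
      rw [Set.image_eq_range]
      have := finrank_span_eq_card hli
      simpa [hi] using this
    rw [hcard, ← hS, rank_subMat]
  rw [heq]
  exact Submodule.subset_span ⟨k, by simp [hk, hki], rfl⟩

end Rank

/-- The order is flipped so that induction starts at sinks and assumes the claim at out-neighbours.
-/
lemma Digraph.AcyclicGraph.wellFounded {V : Type*} [Finite V] {𝒢 : Digraph V}
    (h : 𝒢.AcyclicGraph) : WellFounded (flip (Relation.TransGen 𝒢.Adj)) := by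
  have : IsTrans V (flip (Relation.TransGen 𝒢.Adj)) := ⟨fun _ _ _ hab hbc => hbc.trans hab⟩
  have : Std.Irrefl (flip (Relation.TransGen 𝒢.Adj)) := ⟨fun a ha => h a a ⟨ha, ha⟩⟩
  exact Finite.wellFounded_of_trans_of_irrefl _

/-! ### Network equations and recovery of modules -/

namespace NetworkModelSet

variable {V Θ : Type*} [Fintype V] [DecidableEq V] {M : NetworkModelSet V Θ}

/-- A left kernel vector satisfies `v = v G`, so each entry is a combination of entries at
out-neighbours and vanishes by induction from the sinks. -/
lemma isUnit_one_sub_G (h : M.graph.AcyclicGraph) (θ : Θ) : IsUnit (1 - M.G θ) := by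
  rw [← Matrix.vecMul_injective_iff_isUnit, ← Matrix.coe_vecMulLinear, injective_iff_map_eq_zero]
  intro v hv
  have hv' : v = v ᵥ* M.G θ := by
    rw [Matrix.vecMulLinear_apply, Matrix.vecMul_sub, Matrix.vecMul_one] at hv
    exact sub_eq_zero.1 hv
  ext i
  induction i using h.wellFounded.induction with
  | _ i ih =>
    rw [hv', Pi.zero_apply]
    refine Finset.sum_eq_zero fun j _ => ?_
    by_cases hij : M.graph.Adj i j
    · rw [ih j (Relation.TransGen.single hij), Pi.zero_apply, zero_mul]
    · exact mul_eq_zero_of_right _ (M.G_eq_zero θ i j hij)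

lemma T_apply_eq_sum_outNbrs (h : M.graph.AcyclicGraph) (θ : Θ) (k i : V) :
    M.T θ k i = (1 : Matrix V V (RatFunc ℝ)) k i +
      ∑ j ∈ M.graph.outNbrs i, M.T θ k j * M.G θ j i := by
  have hT : M.T θ = 1 + M.T θ * M.G θ := by
    have h1 : M.T θ * (1 - M.G θ) = 1 :=
      Matrix.nonsing_inv_mul _ ((Matrix.isUnit_iff_isUnit_det _).1 (isUnit_one_sub_G h θ))
    rw [Matrix.mul_sub, Matrix.mul_one] at h1
    exact sub_eq_iff_eq_add.1 h1
  conv_lhs => rw [hT]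
  rw [Matrix.add_apply, Matrix.mul_apply]
  congr 1
  refine (Finset.sum_subset (Finset.subset_univ _) fun j _ hj => ?_).symm
  rw [M.G_eq_zero θ i j (by simpa [Digraph.outNbrs] using hj), mul_zero]

lemma T_apply_eq_sum_inNbrs (h : M.graph.AcyclicGraph) (θ : Θ) (j r : V) :
    M.T θ j r = (1 : Matrix V V (RatFunc ℝ)) j r +
      ∑ k ∈ M.graph.inNbrs j, M.G θ j k * M.T θ k r := by
  have hT : M.T θ = 1 + M.G θ * M.T θ := by
    have h1 : (1 - M.G θ) * M.T θ = 1 :=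
      Matrix.mul_nonsing_inv _ ((Matrix.isUnit_iff_isUnit_det _).1 (isUnit_one_sub_G h θ))
    rw [Matrix.sub_mul, Matrix.one_mul] at h1
    exact sub_eq_iff_eq_add.1 h1
  conv_lhs => rw [hT]
  rw [Matrix.add_apply, Matrix.mul_apply]
  congr 1
  refine (Finset.sum_subset (Finset.subset_univ _) fun k _ hk => ?_).symm
  rw [M.G_eq_zero θ k j (by simpa [Digraph.inNbrs] using hk), zero_mul]

lemma measurement_mul_T_mul_excitation_apply (θ : Θ) (c : {x // x ∈ M.measured})
    (r : {x // x ∈ M.excited}) :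
    (M.measurementMatrix * M.T θ * M.excitationMatrix) c r = M.T θ c r := by
  simp [measurementMatrix, excitationMatrix, Matrix.mul_apply, Matrix.one_apply]

/-- Modulo the span of the rows of `T` indexed by `U \ {i}`, the equation of vertex `j` expresses
row `i` of `T`, scaled by the module `G_{ji}`, through row `j` of `T`. -/
lemma row_equation_mem_span (h : M.graph.AcyclicGraph) {θ : Θ} {i j : V} (hij : M.graph.Adj i j)
    {U W : Finset V} (hi : i ∈ U) (hU : (subMat (M.T θ) U W).rank = U.card)
    (hS : (subMat (M.T θ) ((U ∪ M.dualS i) \ {i}) W).rank = U.card - 1) :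
    M.G θ j i • (fun w : {x // x ∈ W} => M.T θ i w) -
        ((fun w : {x // x ∈ W} => M.T θ j w) -
          fun w : {x // x ∈ W} => (1 : Matrix V V (RatFunc ℝ)) j w) ∈
      Submodule.span (RatFunc ℝ)
        ((fun k (w : {x // x ∈ W}) => M.T θ k w) '' (U.erase i : Set V)) := by
  have hin : i ∈ M.graph.inNbrs j := by simpa [Digraph.inNbrs] using hij
  have hsum : M.G θ j i • (fun w : {x // x ∈ W} => M.T θ i w) -
        ((fun w : {x // x ∈ W} => M.T θ j w) -
          fun w : {x // x ∈ W} => (1 : Matrix V V (RatFunc ℝ)) j w) =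
      -∑ k ∈ (M.graph.inNbrs j).erase i, M.G θ j k • fun w : {x // x ∈ W} => M.T θ k w := by
    ext w
    have := T_apply_eq_sum_inNbrs h θ j w
    rw [← Finset.add_sum_erase _ _ hin] at this
    simp only [Pi.sub_apply, Pi.smul_apply, smul_eq_mul, Pi.neg_apply, Finset.sum_apply]
    linear_combination -this
  rw [hsum]
  refine Submodule.neg_mem _ (Submodule.sum_mem _ fun k hk => Submodule.smul_mem _ _ ?_)
  refine mem_span_of_rank_subMat hi hU hS ?_ (Finset.ne_of_mem_erase hk)
  exact Finset.mem_union_right _ (Finset.mem_biUnion.2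
    ⟨j, by simpa [Digraph.outNbrs] using hij, Finset.mem_of_mem_erase hk⟩)

/-- The modules leaving `i` are determined by the measured and excited block of `T`, if the dual
rank conditions hold at `i`. -/
lemma G_eq_of_dual_rank (h : M.graph.AcyclicGraph) {θ₀ θ₁ : Θ}
    (hT : ∀ c ∈ M.measured, ∀ r ∈ M.excited, M.T θ₁ c r = M.T θ₀ c r)
    {i j : V} (hij : M.graph.Adj i j) {U W : Finset V} (hUC : U ⊆ M.measured)
    (hWR : W ⊆ M.excited) (hi : i ∈ U)
    (hU : ∀ θ, (subMat (M.T θ) U W).rank = U.card)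
    (hS : ∀ θ, (subMat (M.T θ) ((U ∪ M.dualS i) \ {i}) W).rank = U.card - 1) :
    M.G θ₁ j i = M.G θ₀ j i := by
  have hrow : ∀ c ∈ M.measured, (fun w : {x // x ∈ W} => M.T θ₁ c w) =
      fun w : {x // x ∈ W} => M.T θ₀ c w :=
    fun c hc => funext fun w => hT c hc w (hWR w.2)
  have h0 := row_equation_mem_span h hij hi (hU θ₀) (hS θ₀)
  have h1 := row_equation_mem_span h hij hi (hU θ₁) (hS θ₁)
  have himage : (fun k (w : {x // x ∈ W}) => M.T θ₁ k w) '' (U.erase i : Set V) =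
      (fun k (w : {x // x ∈ W}) => M.T θ₀ k w) '' (U.erase i : Set V) :=
    Set.image_congr fun k hk => hrow k (hUC (Finset.mem_of_mem_erase hk))
  have hj : (fun w : {x // x ∈ W} => M.T θ₁ j w) - (fun w : {x // x ∈ W} => M.T θ₀ j w) ∈
      Submodule.span (RatFunc ℝ)
        ((fun k (w : {x // x ∈ W}) => M.T θ₀ k w) '' (U.erase i : Set V)) := by
    by_cases hjm : j ∈ M.measured
    · rw [hrow j hjm, sub_self]
      exact Submodule.zero_mem _
    · have hjS : j ∈ M.dualS i := Finset.mem_union_left _ (Finset.mem_sdiff.2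
        ⟨by simpa [Digraph.outNbrs] using hij, hjm⟩)
      have hji : j ≠ i := fun e => hjm (e ▸ hUC hi)
      refine Submodule.sub_mem _ ?_ (mem_span_of_rank_subMat hi (hU θ₀) (hS θ₀) hjS hji)
      rw [← himage]
      exact mem_span_of_rank_subMat hi (hU θ₁) (hS θ₁) hjS hji
  rw [himage, hrow i (hUC hi)] at h1
  have hdiff : (M.G θ₁ j i - M.G θ₀ j i) • (fun w : {x // x ∈ W} => M.T θ₀ i w) ∈
      Submodule.span (RatFunc ℝ)
        ((fun k (w : {x // x ∈ W}) => M.T θ₀ k w) '' (U.erase i : Set V)) := by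
    -- Subtracting the two row equations cancels the identity rows; `hj` absorbs the difference of
    -- the rows `j`.
    convert! Submodule.add_mem _ (Submodule.sub_mem _ h1 h0) hj using 1
    rw [sub_smul]
    abel
  by_contra hne
  have hmem := (Submodule.smul_mem_iff _ (sub_ne_zero.2 hne)).1 hdiff
  rw [Finset.coe_erase] at hmem
  exact (linearIndepOn_of_rank_subMat (hU θ₀)).notMem_span hi hmem

/-- The modules leaving `i` are determined by column `i` of `T` and the columns of its
out-neighbours, if the latter are independent. -/
lemma G_eq_of_column_rank (h : M.graph.AcyclicGraph) {θ₀ θ₁ : Θ} {i j : V}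
    (hT : ∀ c ∈ M.measured, M.T θ₁ c i = M.T θ₀ c i)
    (hTout : ∀ j ∈ M.graph.outNbrs i, ∀ c ∈ M.measured, M.T θ₁ c j = M.T θ₀ c j)
    (hrank : (subMat (M.T θ₀) M.measured (M.graph.outNbrs i)).rank = (M.graph.outNbrs i).card)
    (hij : M.graph.Adj i j) : M.G θ₁ j i = M.G θ₀ j i := by
  -- Subtracting the column equations for the two parameters puts the difference of the modules
  -- leaving `i` in the kernel of a block of full column rank.
  refine sub_eq_zero.1 (eq_zero_of_rank_subMat (x := fun k => M.G θ₁ k i - M.G θ₀ k i) hrank ?_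
    (by simpa [Digraph.outNbrs] using hij))
  intro c hc
  have h0 := T_apply_eq_sum_outNbrs h θ₀ c i
  have h1 := T_apply_eq_sum_outNbrs h θ₁ c i
  rw [hT c hc, Finset.sum_congr rfl fun j hj => by rw [hTout j hj c hc]] at h1
  simp only [mul_sub, Finset.sum_sub_distrib]
  linear_combination h0 - h1

end NetworkModelSet

theorem mainTheorem5 {V Θ : Type*} [Fintype V] [DecidableEq V] (M : NetworkModelSet V Θ)
    (hacyclic : M.graph.AcyclicGraph)
    (hcover : M.excited ∪ M.measured = Finset.univ)
    (h1 : ∀ i ∈ M.excited, ∀ θ : Θ,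
      HasNormalRank (subMat (M.T θ) M.measured (M.graph.outNbrs i)) (M.graph.outNbrs i).card)
    (h2 : ∀ i ∈ M.measured, i ∉ M.excited →
      ∃ Ci ⊆ M.measured, ∃ Ri ⊆ M.excited,
        M.unmeasuredOutNbrs i ⊆ Ri ∧ i ∈ Ci ∧
        ∀ θ : Θ,
          HasNormalRank (subMat (M.T θ) Ci Ri) Ci.card ∧
          HasNormalRank (subMat (M.T θ) ((Ci ∪ M.dualS i) \ {i}) Ri) (Ci.card - 1)) :
    M.Identifiable := by
  intro i j hij θ₀ θ₁ heq
  have hT : ∀ c ∈ M.measured, ∀ r ∈ M.excited, M.T θ₁ c r = M.T θ₀ c r := by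
    intro c hc r hr
    have := congrFun (congrFun heq ⟨c, hc⟩) ⟨r, hr⟩
    simpa only [NetworkModelSet.measurement_mul_T_mul_excitation_apply] using this
  have hunexcited : ∀ i, i ∉ M.excited → ∀ j, M.graph.Adj i j → M.G θ₁ j i = M.G θ₀ j i := by
    intro i hi j hij
    have him : i ∈ M.measured :=
      (Finset.mem_union.1 (hcover ▸ Finset.mem_univ i)).resolve_left hi
    obtain ⟨U, hUC, W, hWR, -, hiU, hrank⟩ := h2 i him hi
    exact NetworkModelSet.G_eq_of_dual_rank hacyclic hT hij hUC hWR hiU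
      (fun θ => (hrank θ).1.rank_eq) fun θ => (hrank θ).2.rank_eq
  have hcol : ∀ v, ∀ c ∈ M.measured, M.T θ₁ c v = M.T θ₀ c v := by
    intro v
    induction v using hacyclic.wellFounded.induction with
    | _ v ih =>
      intro c hc
      by_cases hv : v ∈ M.excited
      · exact hT c hc v hv
      · rw [NetworkModelSet.T_apply_eq_sum_outNbrs hacyclic,
          NetworkModelSet.T_apply_eq_sum_outNbrs hacyclic]
        congr 1
        refine Finset.sum_congr rfl fun j hj => ?_
        have hvj : M.graph.Adj v j := by simpa [Digraph.outNbrs] using hj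
        rw [ih j (Relation.TransGen.single hvj) c hc, hunexcited v hv j hvj]
  by_cases hi : i ∈ M.excited
  · exact NetworkModelSet.G_eq_of_column_rank hacyclic (hcol i) (fun j _ => hcol j)
      (h1 i hi θ₀).rank_eq hij
  · exact hunexcited i hi j hij
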